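/- **Proposition 2.1.** All languages are relational. Let $(P_i)_{i\in I}$ be a family of nonempty, pairwise disjoint sets with $|I|\le\omega$, and for each $i\in I$ let $\mathcal{A}_i$ be a structure with universe $P_i$ in an at most countable language $\Sigma(\mathcal{A}_i)$; the languages of different $\mathcal{A}_i$ may share symbols. Let $\mathcal{A}_P$ be the structure with universe $\bigcup_{i\in I}P_i$ whose language consists of $\bigcup_{i\in I}\Sigma(\mathcal{A}_i)$ together with a new unary predicate symbol for each $i\in I$, interpreted by the set $P_i$, and in which each symbol $R\in\bigcup_{i\in I}\Sigma(\mathcal{A}_i)$ is interpreted by the union of its interpretations $R^{\mathcal{A}_i}$ over those $i$ with $R\in\Sigma(\mathcal{A}_i)$. Suppose that $\mathcal{A}_P$ is infinite. Then the theory $\mathrm{Th}(\mathcal{A}_P)$ is $\omega$-categorical if and only if $I$ is finite and each structure $\mathcal{A}_i$ is either finite or $\omega$-categorical. Here a structure is called $\omega$-categorical if its complete theory is $\omega$-categorical, that is, if any two countably infinite models of that theory are isomorphic. -/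

import Mathlib

open FirstOrder Cardinal

universe u v w

namespace PComb


/-- The relational language whose `n`-ary predicate symbols are the elements of `S n`, a set of
symbols taken from a common stock `Sym n` of `n`-ary symbols. Two languages `relLang S`,
`relLang S'` over the same stock may share symbols. -/
def relLang {Sym : ℕ → Type u} (S : ∀ n, Set (Sym n)) : FirstOrder.Language.{0, u} where
  Functions _ := Empty
  Relations n := S n

/-- The union of the languages `relLang (S i)`, `i ∈ I`. -/
def unionLang {Sym : ℕ → Type u} {I : Type v} (S : I → ∀ n, Set (Sym n)) : FirstOrder.Language.{0, u} :=
  relLang (fun n => ⋃ i, S i n)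

/-- One unary predicate symbol for each `i : I`, and no other symbol. -/
inductive PSymbol (I : Type v) : ℕ → Type v
  | pred (i : I) : PSymbol I 1

/-- The language consisting of the unary predicate symbols `P_i`, `i ∈ I`. -/
def predLang (I : Type v) : FirstOrder.Language.{0, v} where
  Functions _ := Empty
  Relations n := PSymbol I n

/-- The language of the `P`-union: all symbols of the languages `relLang (S i)` together with
the unary predicate symbols `P_i`, which are new. -/
abbrev combLang {Sym : ℕ → Type u} {I : Type v} (S : I → ∀ n, Set (Sym n)) :
    FirstOrder.Language.{0, max u v} :=
  (unionLang S).sum (predLang I)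

/-- The universe of the `P`-union: the union of the universes `P i`. -/
def PUnion {I : Type v} {M : Type w} (P : I → Set M) : Type w :=
  {x : M // ∃ i, x ∈ P i}

/-- The union of the structures `𝒜 i`: a symbol `R` holds of a tuple iff `R` belongs to the
language of some `𝒜 i` whose universe contains the tuple and in which `R` holds of it. -/
instance unionStructure {Sym : ℕ → Type u} {I : Type v} {M : Type w}
    (S : I → ∀ n, Set (Sym n)) (P : I → Set M) [𝒜 : ∀ i, (relLang (S i)).Structure (P i)] :
    (unionLang S).Structure (PUnion P) where
  funMap f _ := nomatch f
  RelMap {n} R x := ∃ (i : I) (hR : R.1 ∈ S i n) (hx : ∀ k, (x k).1 ∈ P i),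
    (𝒜 i).RelMap (⟨R.1, hR⟩ : S i n) (fun k => ⟨(x k).1, hx k⟩)

/-- The symbol `P_i` is interpreted by the set `P i`. -/
instance predStructure {I : Type v} {M : Type w} (P : I → Set M) :
    (predLang I).Structure (PUnion P) where
  funMap f _ := nomatch f
  RelMap
    | .pred i, x => (x 0).1 ∈ P i

/-- The complete theory of the structure `A` is `ω`-categorical: any two countably infinite models
of it are isomorphic. (This holds vacuously when `A` is finite.) Every countable structure has an
isomorphic copy in `Type`, so it suffices to quantify over models there. -/
def OmegaCategorical (L : FirstOrder.Language.{0, u}) (A : Type w) [L.Structure A] : Prop :=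
  Categorical (ℵ₀ : Cardinal.{0}) (L.completeTheory A)

end PComb

namespace PComb

open FirstOrder.Language Structure CategoryTheory

/-! By `nonempty_sigma_equiv_pUnion` the `P`-union may be replaced by the disjoint union `Σ i, P i`.

Let `I` be finite. That each element satisfies exactly one `P_i`, and that a relation holds only
inside one `P_i`, is then first-order, so every model of the theory splits into models of the
component theories (`exists_equiv_sigma`). Two countable models are matched piece by piece: finite
pieces by `nonempty_equiv_of_finite`, infinite ones by `ω`-categoricity.

Conversely, if `I` is infinite, a nonprincipal ultrapower has an element outside every `P_i`, so
some countable model has such an element while another has none. If `I` is finite, two countable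
models of one component theory are put in turn into a fixed countable model of the whole. A
Feferman–Vaught argument (`exists_local_formulas`) shows that the theory of the whole is unchanged;
the resulting isomorphism of the wholes then restricts to the component. -/

/-! ### Finite structures -/

/-- A structure elementarily equivalent to a finite structure is isomorphic to it. -/
theorem nonempty_equiv_of_finite {L : FirstOrder.Language} {M N : Type*} [L.Structure M]
    [L.Structure N] [Finite M] (h : M ≅[L] N) : Nonempty (M ≃[L] N) := by
  classical
  have hcard : ∀ n : ℕ, (n : Cardinal) ≤ #M ↔ (n : Cardinal) ≤ #N := fun n => by
    have := h.realize_sentence (Sentence.cardGe L n)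
    rwa [Sentence.realize_cardGe, Sentence.realize_cardGe] at this
  have hfin : Finite N := by
    by_contra hN
    rw [not_finite_iff_infinite] at hN
    have h1 := (hcard (Nat.card M + 1)).2 ((natCast_lt_aleph0).le.trans (aleph0_le_mk N))
    rw [← Nat.cast_card] at h1
    exact absurd (Nat.cast_le.1 h1) (by omega)
  have hMN : Nat.card M = Nat.card N := by
    apply le_antisymm
    · have := (hcard (Nat.card M)).1 (Nat.cast_card).le
      rw [← Nat.cast_card] at this
      exact Nat.cast_le.1 this
    · have := (hcard (Nat.card N)).2 (Nat.cast_card).le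
      rw [← Nat.cast_card] at this
      exact Nat.cast_le.1 this
  -- There are finitely many maps `M → N`. Choosing for each a formula that it violates, if there is
  -- one, condenses the type of the enumeration `id` of `M` into one finite conjunction.
  have hsep : ∀ f : M → N, ∃ φ : L.Formula M, φ.Realize (id : M → M) ∧
      (φ.Realize f → ∀ ψ : L.Formula M, ψ.Realize (id : M → M) → ψ.Realize f) := by
    intro f
    by_cases hf : ∀ ψ : L.Formula M, ψ.Realize (id : M → M) → ψ.Realize f
    · exact ⟨⊤, Formula.realize_top.2 trivial, fun _ => hf⟩
    · push Not at hf
      obtain ⟨ψ, h1, h2⟩ := hf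
      exact ⟨ψ, h1, fun h3 => absurd h3 h2⟩
  choose Φ hΦ hΦ' using hsep
  let χ : L.Sentence := Formula.iExs M ((Formula.iInf Φ).relabel (Sum.inr : M → Empty ⊕ M))
  have hχ : M ⊨ χ := by
    refine Formula.realize_iExs.2 ⟨id, ?_⟩
    rw [Formula.realize_relabel, Formula.realize_iInf]
    exact hΦ
  obtain ⟨f, hf⟩ := Formula.realize_iExs.1 ((h.realize_sentence χ).1 hχ)
  rw [Formula.realize_relabel, Formula.realize_iInf] at hf
  have htype : ∀ ψ : L.Formula M, ψ.Realize f ↔ ψ.Realize (id : M → M) := fun ψ => by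
    refine ⟨fun h1 => ?_, fun h1 => hΦ' f (hf f) ψ h1⟩
    by_contra h2
    exact (Formula.realize_not.1 (hΦ' f (hf f) ψ.not (Formula.realize_not.2 h2))) h1
  have hinj : Function.Injective f := fun x y hxy => by
    simpa using (htype ((Term.var x).equal (Term.var y))).1 (by simpa using hxy)
  have hbij : Function.Bijective f := by
    have := Fintype.ofFinite M
    have := Fintype.ofFinite N
    refine (Fintype.bijective_iff_injective_and_card f).2 ⟨hinj, ?_⟩
    simpa [Nat.card_eq_fintype_card] using hMN
  refine ⟨{ Equiv.ofBijective f hbij with map_fun' := fun {n} F x => ?_, map_rel' := fun {n} R x => ?_ }⟩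
  · have := (htype ((Term.func F (fun i => Term.var (x i))).equal (Term.var (funMap F x)))).2
      (by simp)
    simpa [Function.comp_def] using this.symm
  · have := htype (R.formula (fun i => Term.var (x i)))
    simpa [Function.comp_def] using this

/-! ### Feferman–Vaught for finite disjoint unions -/

/-- Finitely many formulas in the variables `V ⊕ β` are controlled, after quantifying over the
variables in `β`, by finitely many formulas in the variables `V`. -/
theorem exists_finite_formulas_extension {L : FirstOrder.Language} {V β : Type*} [Finite β]
    {Θ : Set (L.Formula (V ⊕ β))} (hΘ : Θ.Finite) :
    ∃ Θ' : Set (L.Formula V), Θ'.Finite ∧ ∀ (M N : Type w) [L.Structure M] [L.Structure N]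
      (a : V → M) (b : V → N), (∀ χ ∈ Θ', χ.Realize a ↔ χ.Realize b) →
      ∀ a' : β → M, ∃ b' : β → N, ∀ θ ∈ Θ,
        (θ.Realize (Sum.elim a a') ↔ θ.Realize (Sum.elim b b')) := by
  classical
  have : Finite Θ := hΘ
  -- `χ s` says that some `β`-tuple realizes, among the formulas of `Θ`, exactly those in `s`.
  let χ : Set (L.Formula (V ⊕ β)) → L.Formula V := fun s =>
    Formula.iExs β (Formula.iInf fun θ : Θ => if θ.1 ∈ s then θ.1 else θ.1.not)
  refine ⟨χ '' Θ.powerset, hΘ.powerset.image _, fun M N _ _ a b hab a' => ?_⟩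
  let s : Set (L.Formula (V ⊕ β)) := {θ | θ ∈ Θ ∧ θ.Realize (Sum.elim a a')}
  have hs : (χ s).Realize a := by
    refine Formula.realize_iExs.2 ⟨a', Formula.realize_iInf.2 fun θ => ?_⟩
    split_ifs with h
    · exact h.2
    · exact Formula.realize_not.2 fun h' => h ⟨θ.2, h'⟩
  obtain ⟨b', hb'⟩ := Formula.realize_iExs.1
    ((hab (χ s) ⟨s, fun θ hθ => hθ.1, rfl⟩).1 hs)
  refine ⟨b', fun θ hθ => ?_⟩
  have hθ' := Formula.realize_iInf.1 hb' ⟨θ, hθ⟩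
  by_cases h : θ ∈ s
  · rw [if_pos h] at hθ'
    exact iff_of_true h.2 hθ'
  · rw [if_neg h] at hθ'
    exact iff_of_false (fun h' => h ⟨hθ, h'⟩) (Formula.realize_not.1 hθ')

/-- A tuple of elements, coloured by `c`, satisfies the predicate symbol `P_i` iff its entry has
colour `i`. -/
def PSymbol.Holds {I : Type v} {X : Type*} (c : X → I) : ∀ {n}, PSymbol I n → (Fin n → X) → Prop
  | _, .pred i, x => c (x 0) = i

variable {Sym : ℕ → Type u} {I : Type v}

/-- The disjoint union of a family of structures, in the language of the `P`-union. -/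
instance sigmaStructure (S : I → ∀ n, Set (Sym n)) (C : I → Type w)
    [∀ i, (relLang (S i)).Structure (C i)] : (combLang S).Structure (Σ i, C i) where
  funMap f := Sum.elim (fun f => nomatch f) (fun f => nomatch f) f
  RelMap {n} := Sum.elim
    (fun R x => ∃ (i : I) (hR : R.1 ∈ S i n) (y : Fin n → C i),
      (x = fun k => ⟨i, y k⟩) ∧ RelMap (L := relLang (S i)) (⟨R.1, hR⟩ : S i n) y)
    (fun p x => PSymbol.Holds Sigma.fst p x)

theorem exists_eq_var {S : I → ∀ n, Set (Sym n)} {α : Type*} (t : (combLang S).Term α) :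
    ∃ x, t = Term.var x := by
  cases t with
  | var x => exact ⟨x, rfl⟩
  | func f _ => exact Sum.elim (fun f => nomatch f) (fun f => nomatch f) f

/-- The truth of a formula in a finite disjoint union of structures is determined by the truth of
finitely many formulas in the individual structures. -/
theorem exists_local_formulas [Finite I] {S : I → ∀ n, Set (Sym n)} {α : Type*} {n : ℕ}
    (φ : (combLang S).BoundedFormula α n) :
    -- `V i` holds the variables that range over component `i`; `e` and `f` assign the variables of
    -- `φ` to components.
    ∀ (V : I → Type) (e : α → Σ i, V i) (f : Fin n → Σ i, V i),
      ∃ Θ : ∀ i, Set ((relLang (S i)).Formula (V i)), (∀ i, (Θ i).Finite) ∧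
        ∀ (C D : I → Type w) [∀ i, (relLang (S i)).Structure (C i)]
          [∀ i, (relLang (S i)).Structure (D i)] (a : ∀ i, V i → C i) (b : ∀ i, V i → D i),
          (∀ i, ∀ θ ∈ Θ i, (θ.Realize (a i) ↔ θ.Realize (b i))) →
          φ.Realize (Sigma.map id a ∘ e) (Sigma.map id a ∘ f) →
          φ.Realize (Sigma.map id b ∘ e) (Sigma.map id b ∘ f) := by
  induction φ with
  | falsum => exact fun V e f => ⟨fun _ => ∅, fun _ => Set.finite_empty, fun _ _ _ _ _ _ _ h => h⟩
  | equal t₁ t₂ =>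
    intro V e f
    obtain ⟨x, rfl⟩ := exists_eq_var t₁
    obtain ⟨y, rfl⟩ := exists_eq_var t₂
    refine ⟨fun i => {θ | ∃ x' y', Sum.elim e f x = ⟨i, x'⟩ ∧ Sum.elim e f y = ⟨i, y'⟩ ∧
      θ = (Term.var x').equal (Term.var y')}, fun i => ?_, fun C D _ _ a b hab h => ?_⟩
    · apply Set.Subsingleton.finite
      rintro _ ⟨x₁, y₁, hx₁, hy₁, rfl⟩ _ ⟨x₂, y₂, hx₂, hy₂, rfl⟩
      rw [hx₁] at hx₂
      rw [hy₁] at hy₂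
      cases hx₂
      cases hy₂
      rfl
    · simp only [BoundedFormula.Realize, Term.realize_var, ← Sum.comp_elim,
        Function.comp_apply] at h ⊢
      rcases hx : Sum.elim e f x with ⟨i, x'⟩
      rcases hy : Sum.elim e f y with ⟨j, y'⟩
      rw [hx, hy] at h
      obtain rfl : i = j := congrArg Sigma.fst h
      have h' : a i x' = a i y' := eq_of_heq (Sigma.mk.inj h).2
      have := (hab i _ ⟨x', y', hx, hy, rfl⟩).1 (by simpa using h')
      exact congrArg (Sigma.mk i) (by simpa using this)
  | @rel n l R ts =>
    intro V e f
    choose x hx using fun k => exists_eq_var (ts k)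
    obtain rfl : ts = fun k => Term.var (x k) := funext hx
    rcases R with R | p
    · refine ⟨fun i => {θ | ∃ (hR : R.1 ∈ S i l) (y : Fin l → V i),
        (∀ k, Sum.elim e f (x k) = ⟨i, y k⟩) ∧
        θ = Relations.formula (L := relLang (S i)) (⟨R.1, hR⟩ : S i l) (fun k => Term.var (y k))},
        fun i => ?_, fun C D _ _ a b hab h => ?_⟩
      · apply Set.Subsingleton.finite
        rintro _ ⟨_, y₁, hy₁, rfl⟩ _ ⟨_, y₂, hy₂, rfl⟩
        obtain rfl : y₁ = y₂ := funext fun k =>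
          eq_of_heq (Sigma.mk.inj ((hy₁ k).symm.trans (hy₂ k))).2
        rfl
      · simp only [BoundedFormula.Realize, Term.realize_var, ← Sum.comp_elim,
          Function.comp_apply] at h ⊢
        obtain ⟨i, hR, z, hz, hRz⟩ := h
        have hy : ∀ k, ∃ y : V i, Sum.elim e f (x k) = ⟨i, y⟩ ∧ a i y = z k := fun k => by
          have hk := congrFun hz k
          rcases hj : Sum.elim e f (x k) with ⟨j, y⟩
          rw [hj] at hk
          obtain rfl : j = i := congrArg Sigma.fst hk
          exact ⟨y, rfl, eq_of_heq (Sigma.mk.inj hk).2⟩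
        choose y hy hyz using hy
        obtain rfl : (fun k => a i (y k)) = z := funext hyz
        have := (hab i _ ⟨hR, y, hy, rfl⟩).1 (Formula.realize_rel.2 hRz)
        refine ⟨i, hR, fun k => b i (y k), funext fun k => ?_, Formula.realize_rel.1 this⟩
        rw [hy k]
        rfl
    · refine ⟨fun _ => ∅, fun _ => Set.finite_empty, fun C D _ _ a b _ h => ?_⟩
      simp only [BoundedFormula.Realize, Term.realize_var, ← Sum.comp_elim,
        Function.comp_apply] at h ⊢
      cases p with
      | pred i => exact h
  | imp φ ψ ihφ ihψ =>
    intro V e f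
    obtain ⟨Θ₁, h₁, H₁⟩ := ihφ V e f
    obtain ⟨Θ₂, h₂, H₂⟩ := ihψ V e f
    refine ⟨fun i => Θ₁ i ∪ Θ₂ i, fun i => (h₁ i).union (h₂ i), fun C D _ _ a b hab h hφ => ?_⟩
    refine H₂ C D a b (fun i θ hθ => hab i θ (Or.inr hθ)) (h ?_)
    -- The antecedent is transferred backwards, from `D` to `C`, so the induction hypothesis must
    -- hold for all pairs of families.
    exact H₁ D C b a (fun i θ hθ => (hab i θ (Or.inl hθ)).symm) hφ
  | @all n φ ih =>
    intro V e f
    -- The quantified element may lie in any component `i`. The type `PLift (i = j)` adds one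
    -- variable to component `i` and none to the others.
    choose Θ hΘ H using fun i => ih (fun j => V j ⊕ PLift (i = j))
      (Sigma.map id (fun _ => Sum.inl) ∘ e)
      (Fin.snoc (α := fun _ => Σ j, V j ⊕ PLift (i = j))
        (Sigma.map id (fun _ => Sum.inl) ∘ f) ⟨i, Sum.inr ⟨rfl⟩⟩)
    choose Θ' hΘ' H' using fun i j => exists_finite_formulas_extension.{w} (hΘ i j)
    refine ⟨fun j => ⋃ i, Θ' i j, fun j => Set.finite_iUnion fun i => hΘ' i j,
      fun C D _ _ a b hab h => ?_⟩
    rintro ⟨i, d⟩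
    choose a' ha' using fun j => H' i j (D j) (C j) (b j) (a j)
      (fun χ hχ => (hab j χ (Set.mem_iUnion.2 ⟨i, hχ⟩)).symm) (fun hij => hij.down ▸ d)
    have key := H i C D (fun j => Sum.elim (a j) (a' j))
      (fun j => Sum.elim (b j) (fun hij => hij.down ▸ d)) (fun j θ hθ => (ha' j θ hθ).symm)
    rw [Fin.comp_snoc, Fin.comp_snoc] at key
    exact key (h ⟨i, a' i ⟨rfl⟩⟩)

/-- Finite disjoint unions preserve elementary equivalence. -/
theorem sigma_elementarilyEquivalent [Finite I] {S : I → ∀ n, Set (Sym n)} {C D : I → Type w}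
    [∀ i, (relLang (S i)).Structure (C i)] [∀ i, (relLang (S i)).Structure (D i)]
    (h : ∀ i, C i ≅[relLang (S i)] D i) : (Σ i, C i) ≅[combLang S] (Σ i, D i) := by
  refine elementarilyEquivalent_iff.2 fun φ => ?_
  obtain ⟨Θ, -, H⟩ := exists_local_formulas.{u, v, w} φ (fun _ => Empty) (fun x => x.elim)
    (fun x => x.elim0)
  have h' : ∀ (i) (θ : (relLang (S i)).Formula Empty) (a : Empty → C i) (b : Empty → D i),
      θ.Realize a ↔ θ.Realize b := fun i θ a b => by
    have := (h i).realize_sentence θ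
    rwa [Sentence.Realize, Sentence.Realize, Subsingleton.elim default a,
      Subsingleton.elim default b] at this
  have h1 := H C D (fun _ x => x.elim) (fun _ x => x.elim) (fun i θ _ => h' i θ _ _)
  have h2 := H D C (fun _ x => x.elim) (fun _ x => x.elim) (fun i θ _ => (h' i θ _ _).symm)
  rw [Sentence.Realize, Sentence.Realize, Formula.Realize, Formula.Realize]
  constructor
  · intro h
    convert h1 (by convert h)
  · intro h
    convert h2 (by convert h)

/-! ### Components and relativization -/

instance isRelational_combLang (S : I → ∀ n, Set (Sym n)) : (combLang S).IsRelational :=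
  fun _ => ⟨fun f => Sum.elim (fun f => nomatch f) (fun f => nomatch f) f⟩

instance isRelational_relLang (S : ∀ n, Set (Sym n)) : (relLang S).IsRelational :=
  fun _ => ⟨fun f => nomatch f⟩

/-- The symbol `P_i` in the language of the `P`-union. -/
def predRel (S : I → ∀ n, Set (Sym n)) (i : I) : (combLang S).Relations 1 :=
  Sum.inr (PSymbol.pred i)

/-- A symbol of the union of the languages, as a symbol of the language of the `P`-union. -/
def unionRel (S : I → ∀ n, Set (Sym n)) {n : ℕ} (R : (unionLang S).Relations n) :
    (combLang S).Relations n :=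
  Sum.inl R

/-- A symbol of the `i`-th language, as a symbol of the language of the `P`-union. -/
def componentRel (S : I → ∀ n, Set (Sym n)) (i : I) {n : ℕ} (R : (relLang (S i)).Relations n) :
    (combLang S).Relations n :=
  unionRel S ⟨R.1, Set.mem_iUnion.2 ⟨i, R.2⟩⟩

theorem relMap_predRel_sigma {S : I → ∀ n, Set (Sym n)} {C : I → Type w}
    [∀ i, (relLang (S i)).Structure (C i)] {i : I} {x : Fin 1 → Σ i, C i} :
    RelMap (predRel S i) x ↔ (x 0).1 = i :=
  Iff.rfl

theorem relMap_unionRel_sigma {S : I → ∀ n, Set (Sym n)} {C : I → Type w}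
    [∀ i, (relLang (S i)).Structure (C i)] {n : ℕ} {R : (unionLang S).Relations n}
    {x : Fin n → Σ i, C i} :
    RelMap (unionRel S R) x ↔ ∃ (i : I) (hR : R.1 ∈ S i n) (y : Fin n → C i),
      (x = fun k => ⟨i, y k⟩) ∧ RelMap (L := relLang (S i)) (⟨R.1, hR⟩ : S i n) y :=
  Iff.rfl

/-- `f` identifies `M` with the part of `N` defined by the predicate `P_i`; nothing is required of
nullary symbols. -/
structure IsComponent (S : I → ∀ n, Set (Sym n)) (i : I) {M N : Type*}
    [(relLang (S i)).Structure M] [(combLang S).Structure N] (f : M → N) : Prop where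
  injective : Function.Injective f
  mem_range : ∀ y, y ∈ Set.range f ↔ RelMap (predRel S i) (fun _ => y)
  map_rel : ∀ {n : ℕ} (R : (relLang (S i)).Relations (n + 1)) (x : Fin (n + 1) → M),
    RelMap (componentRel S i R) (f ∘ x) ↔ RelMap R x

theorem isComponent_sigmaMk {S : I → ∀ n, Set (Sym n)} {C : I → Type w}
    [∀ i, (relLang (S i)).Structure (C i)] (i : I) :
    IsComponent S i (Sigma.mk i : C i → Σ i, C i) where
  injective := sigma_mk_injective
  mem_range := by
    rintro ⟨j, y⟩
    rw [relMap_predRel_sigma]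
    constructor
    · rintro ⟨z, hz⟩
      exact (congrArg Sigma.fst hz).symm
    · rintro rfl
      exact ⟨y, rfl⟩
  map_rel {n} R x := by
    refine relMap_unionRel_sigma.trans ⟨?_, fun h => ⟨i, R.2, x, rfl, h⟩⟩
    rintro ⟨j, hR, y, hy, h⟩
    -- Positive arity is essential: entry `0` determines the component.
    obtain rfl : i = j := congrArg Sigma.fst (congrFun hy 0)
    obtain rfl : x = y := funext fun k => sigma_mk_injective (congrFun hy k)
    exact h

section Relativization

variable {S : I → ∀ n, Set (Sym n)} {i : I} {M N M' N' : Type*}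
  [(relLang (S i)).Structure M] [(combLang S).Structure N]
  [(relLang (S i)).Structure M'] [(combLang S).Structure N'] {f : M → N} {f' : M' → N'}

/-- Relativization of formulas to a component. -/
theorem IsComponent.exists_relativization (hf : IsComponent S i f) (hf' : IsComponent S i f')
    (h0 : ∀ (R : (relLang (S i)).Relations 0) x x', RelMap R (x : Fin 0 → M) ↔
      RelMap R (x' : Fin 0 → M'))
    {α : Type*} {n : ℕ} (φ : (relLang (S i)).BoundedFormula α n) :
    ∃ ψ : (combLang S).BoundedFormula α n,
      (∀ v xs, ψ.Realize (f ∘ v) (f ∘ xs) ↔ φ.Realize v xs) ∧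
      ∀ v xs, ψ.Realize (f' ∘ v) (f' ∘ xs) ↔ φ.Realize v xs := by
  have hvar : ∀ {β : Type _} (t : (relLang (S i)).Term β), ∃ x, t = Term.var x := fun t => by
    cases t with
    | var x => exact ⟨x, rfl⟩
    | func f _ => exact nomatch f
  induction φ with
  | falsum => exact ⟨⊥, fun _ _ => Iff.rfl, fun _ _ => Iff.rfl⟩
  | equal t₁ t₂ =>
    obtain ⟨x, rfl⟩ := hvar t₁
    obtain ⟨y, rfl⟩ := hvar t₂
    refine ⟨(Term.var x).bdEqual (Term.var y), fun v xs => ?_, fun v xs => ?_⟩ <;>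
      simp only [BoundedFormula.realize_bdEqual, BoundedFormula.Realize, Term.realize_var,
        ← Sum.comp_elim, Function.comp_apply]
    · exact hf.injective.eq_iff
    · exact hf'.injective.eq_iff
  | @rel n l R ts =>
    choose x hx using fun k => hvar (ts k)
    obtain rfl : ts = fun k => Term.var (x k) := funext hx
    cases l with
    | zero =>
      -- In the union a nullary symbol records only whether it holds in some component. No formula
      -- need recover its value in component `i`, so that value is hard-coded as `⊤` or `⊥`, by `h0`
      -- the same for `M` and `M'`.
      by_cases h : RelMap R (default : Fin 0 → M')
      · exact ⟨⊤, fun v xs => iff_of_true (BoundedFormula.realize_top.2 trivial)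
          ((h0 R _ _).2 h), fun v xs => iff_of_true (BoundedFormula.realize_top.2 trivial)
          (by simpa [BoundedFormula.Realize, Subsingleton.elim _ (default : Fin 0 → M')] using h)⟩
      · exact ⟨⊥, fun v xs => iff_of_false id (fun h' => h ((h0 R _ _).1 h')),
          fun v xs => iff_of_false id fun h' => h
          (by simpa [BoundedFormula.Realize, Subsingleton.elim _ (default : Fin 0 → M')] using h')⟩
    | succ l =>
      refine ⟨(componentRel S i R).boundedFormula fun k => Term.var (x k),
        fun v xs => ?_, fun v xs => ?_⟩ <;>
        simp only [BoundedFormula.realize_rel, BoundedFormula.Realize, Term.realize_var,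
          ← Sum.comp_elim, Function.comp_apply]
      · exact hf.map_rel R fun k => Sum.elim v xs (x k)
      · exact hf'.map_rel R fun k => Sum.elim v xs (x k)
  | imp φ₁ φ₂ ih₁ ih₂ =>
    obtain ⟨ψ₁, h₁, h₁'⟩ := ih₁
    obtain ⟨ψ₂, h₂, h₂'⟩ := ih₂
    exact ⟨ψ₁.imp ψ₂, fun v xs => imp_congr (h₁ v xs) (h₂ v xs),
      fun v xs => imp_congr (h₁' v xs) (h₂' v xs)⟩
  | @all n φ ih =>
    obtain ⟨ψ, h, h'⟩ := ih
    refine ⟨(((predRel S i).boundedFormula fun _ => Term.var (Sum.inr (Fin.last n))).imp ψ).all,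
      fun v xs => ?_, fun v xs => ?_⟩ <;>
      simp only [BoundedFormula.realize_all, BoundedFormula.realize_imp,
        BoundedFormula.realize_rel, Term.realize_var, Sum.elim_inr, Fin.snoc_last]
    · simp only [← hf.mem_range, Set.forall_mem_range, ← Fin.comp_snoc, h]
    · simp only [← hf'.mem_range, Set.forall_mem_range, ← Fin.comp_snoc, h']

/-- The same relativized sentence works for both embeddings, so its truth can be compared in `N` and
`N'`. -/
theorem IsComponent.elementarilyEquivalent (hf : IsComponent S i f) (hf' : IsComponent S i f')
    (h0 : ∀ (R : (relLang (S i)).Relations 0) x x', RelMap R (x : Fin 0 → M) ↔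
      RelMap R (x' : Fin 0 → M'))
    (h : N ≅[combLang S] N') : M ≅[relLang (S i)] M' := by
  refine elementarilyEquivalent_iff.2 fun φ => ?_
  obtain ⟨ψ, h₁, h₂⟩ := hf.exists_relativization hf' h0 φ
  have h₁ := h₁ default default
  have h₂ := h₂ default default
  rw [Subsingleton.elim (f ∘ _) default, Subsingleton.elim (f ∘ _) default] at h₁
  rw [Subsingleton.elim (f' ∘ _) default, Subsingleton.elim (f' ∘ _) default] at h₂
  exact h₁.symm.trans ((h.realize_sentence ψ).trans h₂)

/-- An isomorphism restricts to the components. -/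
theorem IsComponent.nonempty_equiv (hf : IsComponent S i f) (hf' : IsComponent S i f')
    (h0 : ∀ (R : (relLang (S i)).Relations 0) x x', RelMap R (x : Fin 0 → M) ↔
      RelMap R (x' : Fin 0 → M'))
    (e : N ≃[combLang S] N') : Nonempty (M ≃[relLang (S i)] M') := by
  have key : ∀ y, e y ∈ Set.range f' ↔ y ∈ Set.range f := fun y => by
    rw [hf.mem_range, hf'.mem_range, ← StrongHomClass.map_rel e]
    rfl
  choose g hg using fun x => (key (f x)).2 ⟨x, rfl⟩
  have hbij : Function.Bijective g := by
    refine ⟨fun x y hxy => hf.injective (e.injective ?_), fun y => ?_⟩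
    · rw [← hg, ← hg, hxy]
    · obtain ⟨x, hx⟩ := (key (e.symm (f' y))).1 (by simp)
      exact ⟨x, hf'.injective (by rw [hg, hx]; exact e.apply_symm_apply _)⟩
  refine ⟨{ Equiv.ofBijective g hbij with
    map_fun' := fun {n} F => isEmptyElim F, map_rel' := fun {n} R x => ?_ }⟩
  cases n with
  | zero => exact (h0 R _ _).symm
  | succ n =>
    change RelMap R (g ∘ x) ↔ RelMap R x
    rw [← hf.map_rel, ← hf'.map_rel, ← StrongHomClass.map_rel e]
    exact iff_of_eq (congrArg _ (funext fun k => hg (x k)))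

end Relativization

/-! ### Decomposing models of the theory of a disjoint union -/

/-- Used to carry over to an arbitrary model the axioms that characterize a disjoint union. -/
theorem ElementarilyEquivalent.forall_realize {L : FirstOrder.Language} {M N : Type*}
    [L.Structure M] [L.Structure N] (h : M ≅[L] N) {β : Type*} [Finite β] (φ : L.Formula β)
    (hφ : ∀ x : β → M, φ.Realize x) (x : β → N) : φ.Realize x := by
  have := (h.realize_sentence (Formula.iAlls β (φ.relabel (Sum.inr : β → Empty ⊕ β)))).1
    (Formula.realize_iAlls.2 fun y => Formula.realize_relabel.2 (hφ y))
  have hx := Formula.realize_iAlls.1 this x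
  exact (Formula.realize_relabel (g := (Sum.inr : β → Empty ⊕ β))).1 hx

theorem relMap_nullary_iff {L : FirstOrder.Language} {M N : Type*}
    [L.Structure M] [L.Structure N] (h : M ≅[L] N) (R : L.Relations 0) (x : Fin 0 → M)
    (y : Fin 0 → N) : RelMap R x ↔ RelMap R y := by
  have := h.realize_sentence (R.formula (fun k => k.elim0))
  rw [Sentence.Realize, Sentence.Realize, Formula.realize_rel, Formula.realize_rel] at this
  rwa [Subsingleton.elim x, Subsingleton.elim y]

/-- The part of a structure `N` defined by the predicate `P_i`; as a structure, it has the nullary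
symbols interpreted as in `A`. -/
def Component (S : I → ∀ n, Set (Sym n)) (i : I) (_A : Type*) (N : Type*)
    [(combLang S).Structure N] :=
  {y : N // RelMap (predRel S i) (fun _ => y)}

instance componentStructure (S : I → ∀ n, Set (Sym n)) (i : I) (A : Type*) (N : Type*)
    [(relLang (S i)).Structure A] [(combLang S).Structure N] :
    (relLang (S i)).Structure (Component S i A N) where
  funMap f := isEmptyElim f
  RelMap {n} := match n with
    | 0 => fun R _ => RelMap (M := A) R default
    | _ + 1 => fun R x => RelMap (componentRel S i R) (fun k => (x k).1)

/-- A model of the theory of a finite disjoint union is the disjoint union of models of the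
theories of the components. -/
theorem exists_equiv_sigma [Finite I] {S : I → ∀ n, Set (Sym n)} {A : I → Type*}
    [∀ i, (relLang (S i)).Structure (A i)] {N : Type w} [(combLang S).Structure N]
    (h : (Σ i, A i) ≅[combLang S] N) :
    ∃ B : ∀ i, Bundled.{w} (relLang (S i)).Structure, (∀ i, A i ≅[relLang (S i)] B i) ∧
      Nonempty ((Σ i, B i) ≃[combLang S] N) := by
  have hB : ∀ i, IsComponent S i (fun y : Component S i (A i) N => y.1) := fun i =>
    { injective := Subtype.val_injective
      mem_range := fun y => ⟨fun ⟨z, hz⟩ => hz ▸ z.2, fun hy => ⟨⟨y, hy⟩, rfl⟩⟩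
      map_rel := fun R x => Iff.rfl }
  refine ⟨fun i => ⟨Component S i (A i) N, inferInstance⟩,
    fun i => (isComponent_sigmaMk i).elementarilyEquivalent (hB i)
      (fun R x x' => by rw [Subsingleton.elim x default]; rfl) h, ?_⟩
  change Nonempty ((Σ i, Component S i (A i) N) ≃[combLang S] N)
  -- Finiteness of `I` enters here: "some `P_i` holds" is a finite disjunction.
  have hex : ∀ y : N, ∃ i, RelMap (predRel S i) (fun _ => y) := fun y => by
    have := ElementarilyEquivalent.forall_realize h
      (Formula.iSup fun i => (predRel S i).formula fun _ => Term.var ())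
      (fun x => Formula.realize_iSup.2 ⟨(x ()).1, Formula.realize_rel.2 rfl⟩) (fun _ => y)
    obtain ⟨i, hi⟩ := Formula.realize_iSup.1 this
    exact ⟨i, Formula.realize_rel.1 hi⟩
  have huniq : ∀ (y : N) (i j : I), RelMap (predRel S i) (fun _ => y) →
      RelMap (predRel S j) (fun _ => y) → i = j := fun y i j hi hj => by
    by_contra hij
    have := ElementarilyEquivalent.forall_realize h
      (((predRel S i).formula fun _ => Term.var ()).imp
        ((predRel S j).formula fun _ => Term.var ()).not)
      (fun x => Formula.realize_imp.2 fun h1 => Formula.realize_not.2 fun h2 => hij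
        ((relMap_predRel_sigma.1 (Formula.realize_rel.1 h1)).symm.trans
          (relMap_predRel_sigma.1 (Formula.realize_rel.1 h2)))) (fun _ => y)
    exact Formula.realize_not.1 (Formula.realize_imp.1 this (Formula.realize_rel.2 hi))
      (Formula.realize_rel.2 hj)
  have hrel : ∀ {n : ℕ} (R : (unionLang S).Relations n) (x : Fin n → N),
      RelMap (unionRel S R) x → ∃ i, R.1 ∈ S i n ∧ ∀ k, RelMap (predRel S i) (fun _ => x k) := by
    intro n R x hx
    have := ElementarilyEquivalent.forall_realize h
      (((unionRel S R).formula Term.var).imp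
        (Formula.iSup fun i : {i // R.1 ∈ S i n} => Formula.iInf fun k : Fin n =>
          (predRel S i.1).formula fun _ => Term.var k))
      (fun x => Formula.realize_imp.2 fun h1 => by
        obtain ⟨i, hR, y, hy, -⟩ := relMap_unionRel_sigma.1 (Formula.realize_rel.1 h1)
        refine Formula.realize_iSup.2 ⟨⟨i, hR⟩, Formula.realize_iInf.2 fun k =>
          Formula.realize_rel.2 (relMap_predRel_sigma.2 ?_)⟩
        exact congrArg Sigma.fst (congrFun hy k)) x
    obtain ⟨i, hi⟩ := Formula.realize_iSup.1
      (Formula.realize_imp.1 this (Formula.realize_rel.2 hx))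
    exact ⟨i.1, i.2, fun k => Formula.realize_rel.1 (Formula.realize_iInf.1 hi k)⟩
  let g : (Σ i, Component S i (A i) N) → N := fun x => x.2.1
  have hg : Function.Bijective g := by
    refine ⟨?_, fun y => ?_⟩
    · rintro ⟨i, x, hx⟩ ⟨j, y, hy⟩ (rfl : x = y)
      obtain rfl := huniq x i j hx hy
      rfl
    · obtain ⟨i, hi⟩ := hex y
      exact ⟨⟨i, y, hi⟩, rfl⟩
  refine ⟨{ Equiv.ofBijective g hg with
    map_fun' := fun {n} F => isEmptyElim F, map_rel' := fun {n} R x => ?_ }⟩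
  change RelMap R (g ∘ x) ↔ RelMap R x
  rcases R with R | p
  · cases n with
    | zero =>
      -- Nullary symbols have the same value in `N` as in `Σ i, A i`, and each component copies its
      -- nullary values from `A i`.
      refine (relMap_nullary_iff h _ default _).symm.trans ?_
      refine relMap_unionRel_sigma.trans (Iff.trans ?_ relMap_unionRel_sigma.symm)
      refine exists_congr fun i => exists_congr fun hR => ?_
      constructor
      · rintro ⟨y, -, hy⟩
        exact ⟨default, Subsingleton.elim _ _, by rwa [Subsingleton.elim y default] at hy⟩
      · rintro ⟨y, -, hy⟩
        exact ⟨default, Subsingleton.elim _ _, hy⟩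
    | succ n =>
      refine Iff.trans ⟨fun hx => ?_, ?_⟩ relMap_unionRel_sigma.symm
      · obtain ⟨i, hR, hi⟩ := hrel R (g ∘ x) hx
        exact ⟨i, hR, fun k => ⟨g (x k), hi k⟩, funext fun k => hg.1 rfl, hx⟩
      · rintro ⟨i, hR, y, rfl, hy⟩
        exact hy
  · cases p with
    | pred i =>
      have hx : g ∘ x = fun _ => g (x 0) := funext fun k => by rw [Subsingleton.elim k 0]; rfl
      rw [hx]
      refine Iff.trans ⟨fun h' => huniq _ _ _ (x 0).2.2 h', ?_⟩
        (relMap_predRel_sigma (S := S) (i := i)).symm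
      rintro rfl
      exact (x 0).2.2

/-- Isomorphisms of the components yield an isomorphism of the disjoint unions. -/
theorem nonempty_sigma_equiv {S : I → ∀ n, Set (Sym n)} {C D : I → Type*}
    [∀ i, (relLang (S i)).Structure (C i)] [∀ i, (relLang (S i)).Structure (D i)]
    (e : ∀ i, C i ≃[relLang (S i)] D i) :
    Nonempty ((Σ i, C i) ≃[combLang S] (Σ i, D i)) := by
  refine ⟨{ Equiv.sigmaCongrRight (fun i => (e i).toEquiv) with
    map_fun' := fun {n} F => isEmptyElim F, map_rel' := fun {n} R x => ?_ }⟩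
  rcases R with R | p
  · refine relMap_unionRel_sigma.trans (Iff.trans ?_ relMap_unionRel_sigma.symm)
    refine exists_congr fun i => exists_congr fun hR => ?_
    constructor
    · rintro ⟨y, hy, h⟩
      refine ⟨(e i).symm ∘ y, ?_, (StrongHomClass.map_rel (e i).symm _ _).2 h⟩
      refine funext fun k => (Equiv.sigmaCongrRight (fun i => (e i).toEquiv)).injective ?_
      refine (congrFun hy k).trans ?_
      exact congrArg (Sigma.mk i) ((e i).apply_symm_apply (y k)).symm
    · rintro ⟨y, rfl, h⟩
      exact ⟨e i ∘ y, rfl, (StrongHomClass.map_rel (e i) _ _).2 h⟩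
  · cases p with
    | pred i => exact Iff.rfl

/-- The `P`-union is isomorphic to the disjoint union. -/
theorem nonempty_sigma_equiv_pUnion {M : Type w} (S : I → ∀ n, Set (Sym n)) (P : I → Set M)
    [∀ i, (relLang (S i)).Structure (P i)] (hdisj : ∀ i j, i ≠ j → Disjoint (P i) (P j)) :
    Nonempty ((Σ i, P i) ≃[combLang S] PUnion P) := by
  have huniq : ∀ {i j : I} {x : M}, x ∈ P i → x ∈ P j → i = j := fun {i j x} hi hj => by
    by_contra hij
    exact Set.disjoint_left.1 (hdisj i j hij) hi hj
  let g : (Σ i, P i) → PUnion P := fun x => ⟨x.2.1, x.1, x.2.2⟩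
  have hg : Function.Bijective g := by
    refine ⟨?_, fun ⟨y, i, hi⟩ => ⟨⟨i, y, hi⟩, rfl⟩⟩
    rintro ⟨i, x, hx⟩ ⟨j, y, hy⟩ hxy
    obtain rfl : x = y := congrArg Subtype.val hxy
    obtain rfl := huniq hx hy
    rfl
  refine ⟨{ Equiv.ofBijective g hg with
    map_fun' := fun {n} F => isEmptyElim F, map_rel' := fun {n} R x => ?_ }⟩
  change RelMap R (g ∘ x) ↔ RelMap R x
  rcases R with R | p
  · refine Iff.trans ?_ relMap_unionRel_sigma.symm
    constructor
    · rintro ⟨i, hR, hx, h⟩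
      exact ⟨i, hR, fun k => ⟨(g (x k)).1, hx k⟩, funext fun k => hg.1 rfl, h⟩
    · rintro ⟨i, hR, y, rfl, h⟩
      exact ⟨i, hR, fun k => (y k).2, h⟩
  · cases p with
    | pred i =>
      refine Iff.trans ⟨fun h => huniq (x 0).2.2 h, ?_⟩ (relMap_predRel_sigma (S := S)).symm
      rintro rfl
      exact (x 0).2.2

/-! ### Countable models and `ω`-categoricity -/

theorem card_combLang_le {S : I → ∀ n, Set (Sym n)} (hlang : ∀ i, (relLang (S i)).card ≤ ℵ₀)
    (hI : #I ≤ ℵ₀) : (combLang S).card ≤ ℵ₀ := by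
  have hcI : Countable I := mk_le_aleph0_iff.1 hI
  have hS : ∀ n, Countable (⋃ i, S i n : Set (Sym n)) := fun n => by
    refine (Set.countable_iUnion fun i => ?_).to_subtype
    have : Countable (relLang (S i)).Symbols := mk_le_aleph0_iff.1 (hlang i)
    have hinj : Function.Injective
        (fun R : S i n => (Sum.inr ⟨n, R⟩ : (relLang (S i)).Symbols)) := fun R R' h =>
      eq_of_heq (Sigma.mk.inj (Sum.inr.inj h)).2
    exact Set.countable_coe_iff.1 hinj.countable
  have hP : ∀ n, Countable (PSymbol I n) := fun n => by
    let f : PSymbol I n → I := fun p => match p with | .pred i => i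
    have hf : Function.Injective f := by
      rintro ⟨i⟩ ⟨j⟩ h
      obtain rfl : i = j := h
      rfl
    exact hf.countable
  have : ∀ n, Countable ((combLang S).Relations n) := fun n =>
    inferInstanceAs (Countable ((⋃ i, S i n : Set (Sym n)) ⊕ PSymbol I n))
  have : Countable (combLang S).Symbols := by
    unfold Language.Symbols
    infer_instance
  exact mk_le_aleph0_iff.2 this

/-- Models of arbitrary universe level of an `ω`-categorical theory are isomorphic. -/
theorem OmegaCategorical.nonempty_equiv {L : FirstOrder.Language.{0, u}} {A : Type w}
    [L.Structure A] (h : OmegaCategorical L A) {M N : Type*} [L.Structure M] [L.Structure N]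
    [Countable M] [Infinite M] [Countable N] [Infinite N] (hM : A ≅[L] M) (hN : A ≅[L] N) :
    Nonempty (M ≃[L] N) := by
  have hM' : M ⊨ L.completeTheory A := hM.theory_model
  have hN' : N ⊨ L.completeTheory A := hN.theory_model
  -- Both structures are transported to `ℕ`, which lies in the universe over which
  -- `OmegaCategorical` quantifies.
  obtain ⟨e₁⟩ := nonempty_equiv_of_countable (α := M) (β := ℕ)
  obtain ⟨e₂⟩ := nonempty_equiv_of_countable (α := N) (β := ℕ)
  obtain ⟨e⟩ := h (Theory.ModelType.equivInduced (M := Theory.ModelType.of _ M) e₁)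
    (Theory.ModelType.equivInduced (M := Theory.ModelType.of _ N) e₂) mk_nat mk_nat
  let s₁ := e₁.inducedStructure (L := L)
  let s₂ := e₂.inducedStructure (L := L)
  exact ⟨((e₂.inducedStructureEquiv (L := L)).symm.comp e).comp
    (e₁.inducedStructureEquiv (L := L))⟩

/-- Downward Löwenheim–Skolem; the prescribed set `s` keeps a chosen nonstandard element in the
countable model. -/
theorem exists_countable_elementarySubstructure {L : FirstOrder.Language.{0, u}} {M : Type w}
    [L.Structure M] [Infinite M] (hL : L.card ≤ ℵ₀) (s : Set M) (hs : s.Countable) :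
    ∃ T : L.ElementarySubstructure M, s ⊆ T ∧ Countable T ∧ Infinite T := by
  obtain ⟨T, hT, hcard⟩ := exists_elementarySubstructure_card_eq L s (ℵ₀ : Cardinal.{0}) le_rfl
    (by simpa using hs) (by simpa using hL) (by simp)
  rw [lift_aleph0, lift_uzero] at hcard
  exact ⟨T, hT, mk_le_aleph0_iff.1 hcard.le, infinite_iff.2 hcard.ge⟩

/-- A disjoint union of infinitely many structures is not `ω`-categorical. -/
theorem finite_of_omegaCategorical_sigma {S : I → ∀ n, Set (Sym n)} {A : I → Type w}
    [∀ i, (relLang (S i)).Structure (A i)] [∀ i, Nonempty (A i)]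
    (hcard : (combLang S).card ≤ ℵ₀) (h : OmegaCategorical (combLang S) (Σ i, A i)) :
    Finite I := by
  by_contra hI
  rw [not_finite_iff_infinite] at hI
  have a : ∀ i, A i := fun i => Classical.arbitrary _
  have : Infinite (Σ i, A i) :=
    Infinite.of_injective (fun i => (⟨i, a i⟩ : Σ i, A i)) fun i j hij => congrArg Sigma.fst hij
  let U := (Filter.hyperfilter I : Filter I).Product fun _ => Σ i, A i
  have hU : (Σ i, A i) ≅[combLang S] U := elementarilyEquivalent_iff.2 fun φ => by
    rw [Ultraproduct.sentence_realize, Filter.eventually_const]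
  have : Infinite U := hU.infinite
  -- The diagonal class: its `j`-th coordinate lies in component `j`, so it satisfies `P_i` only on
  -- `{i}`, a null set for the ultrafilter.
  let c : U := ((fun i => ⟨i, a i⟩ : ∀ _ : I, Σ i, A i) : U)
  have hc : ∀ i, ¬ RelMap (predRel S i) (fun _ => c) := fun i hi => by
    have := (Ultraproduct.realize_formula_cast (u := Filter.hyperfilter I)
      (M := fun _ : I => Σ i, A i) ((predRel S i).formula fun _ => Term.var ())
      (fun _ j => ⟨j, a j⟩)).1 (Formula.realize_rel.2 hi)
    simp only [Formula.realize_rel, Term.realize_var, relMap_predRel_sigma] at this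
    exact Filter.notMem_hyperfilter_of_finite (Set.finite_singleton i) this
  obtain ⟨T, hT, _, _⟩ := exists_countable_elementarySubstructure hcard {c}
    (Set.countable_singleton c)
  obtain ⟨T', -, _, _⟩ := exists_countable_elementarySubstructure (M := Σ i, A i) hcard ∅
    Set.countable_empty
  obtain ⟨e⟩ := h.nonempty_equiv (hU.trans T.elementarilyEquivalent.symm)
    T'.elementarilyEquivalent.symm
  -- The image of `c` lies in a substructure of `Σ i, A i`, hence satisfies some `P_i`; the
  -- isomorphism reflects this back to `c`.
  let c' : T := ⟨c, hT rfl⟩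
  have hc' : RelMap (predRel S (e c').1.1) (fun _ => e c') := by
    change RelMap (predRel S (e c').1.1) (fun _ => (e c').1)
    exact relMap_predRel_sigma.2 rfl
  exact hc _ ((StrongHomClass.map_rel e (predRel S (e c').1.1) (fun _ => c')).1 hc')

/-- The components of an infinite `ω`-categorical finite disjoint union are finite or
`ω`-categorical. -/
theorem omegaCategorical_component [Finite I] {S : I → ∀ n, Set (Sym n)} {A : I → Type w}
    [∀ i, (relLang (S i)).Structure (A i)] [Infinite (Σ i, A i)]
    (hcard : (combLang S).card ≤ ℵ₀) (h : OmegaCategorical (combLang S) (Σ i, A i)) (i : I) :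
    OmegaCategorical (relLang (S i)) (A i) := by
  classical
  intro M₁ M₂ hM₁ hM₂
  obtain ⟨N, hN, hNcard⟩ := exists_elementarilyEquivalent_card_eq (combLang S) (Σ i, A i)
    (ℵ₀ : Cardinal.{0}) le_rfl (by simpa using hcard)
  obtain ⟨F, hF, ⟨eF⟩⟩ := exists_equiv_sigma hN
  have hNc : Countable N := mk_le_aleph0_iff.1 hNcard.le
  have hFc : ∀ j, Countable (F j) := fun j =>
    (eF.injective.comp (sigma_mk_injective (i := j))).countable
  -- `G M` is the decomposition `F` of a countable model with its `i`-th piece replaced by `M`.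
  let G : (relLang (S i)).completeTheory (A i) |>.ModelType → ∀ j,
      Bundled.{0} (relLang (S j)).Structure := fun M => Function.update F i ⟨M, inferInstance⟩
  have hM : ∀ M : ((relLang (S i)).completeTheory (A i)).ModelType, A i ≅[relLang (S i)] M :=
    fun M => elementarilyEquivalent_iff.2 fun φ =>
      (realize_iff_of_model_completeTheory (A i) M φ).symm
  have hG : ∀ M j, A j ≅[relLang (S j)] G M j := fun M =>
    (Function.forall_update_iff F (p := fun j X => A j ≅[relLang (S j)] X)).2
      ⟨hM M, fun j _ => hF j⟩
  have hGc : ∀ M : ((relLang (S i)).completeTheory (A i)).ModelType, #M = ℵ₀ →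
      ∀ j, Countable (G M j) := fun M hMc =>
    (Function.forall_update_iff F (p := fun j X => Countable X)).2
      ⟨mk_le_aleph0_iff.1 hMc.le, fun j _ => hFc j⟩
  have hGN : ∀ M, (Σ j, A j) ≅[combLang S] (Σ j, G M j) := fun M =>
    (hN.trans (StrongHomClass.elementarilyEquivalent eF).symm).trans
      (sigma_elementarilyEquivalent fun j => (hF j).symm.trans (hG M j))
  have := hGc M₁ hM₁
  have := hGc M₂ hM₂
  have : Countable I := Finite.to_countable
  have : Infinite (Σ j, G M₁ j) := (hGN M₁).infinite
  have : Infinite (Σ j, G M₂ j) := (hGN M₂).infinite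
  obtain ⟨e⟩ := h.nonempty_equiv (hGN M₁) (hGN M₂)
  have he : Nonempty (G M₁ i ≃[relLang (S i)] G M₂ i) :=
    (isComponent_sigmaMk i).nonempty_equiv (isComponent_sigmaMk i)
      (relMap_nullary_iff ((hG M₁ i).symm.trans (hG M₂ i))) e
  -- The `i`-th entry of the updated family equals `M` only propositionally; generalizing to `X` and
  -- `Y` lets the equalities be substituted.
  have aux : ∀ X Y : Bundled.{0} (relLang (S i)).Structure, X = ⟨M₁, inferInstance⟩ →
      Y = ⟨M₂, inferInstance⟩ → Nonempty (X ≃[relLang (S i)] Y) →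
      Nonempty (M₁ ≃[relLang (S i)] M₂) := by
    rintro _ _ rfl rfl h
    exact h
  exact aux (G M₁ i) (G M₂ i) (Function.update_self i _ F) (Function.update_self i _ F) he

/-- A finite disjoint union of structures that are finite or `ω`-categorical is
`ω`-categorical. -/
theorem omegaCategorical_sigma [Finite I] {S : I → ∀ n, Set (Sym n)} {A : I → Type w}
    [∀ i, (relLang (S i)).Structure (A i)]
    (h : ∀ i, Finite (A i) ∨ OmegaCategorical (relLang (S i)) (A i)) :
    OmegaCategorical (combLang S) (Σ i, A i) := by
  intro M N hM hN
  have hMA : (Σ i, A i) ≅[combLang S] M := elementarilyEquivalent_iff.2 fun φ =>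
    (realize_iff_of_model_completeTheory _ M φ).symm
  have hNA : (Σ i, A i) ≅[combLang S] N := elementarilyEquivalent_iff.2 fun φ =>
    (realize_iff_of_model_completeTheory _ N φ).symm
  obtain ⟨F, hF, ⟨eF⟩⟩ := exists_equiv_sigma hMA
  obtain ⟨G, hG, ⟨eG⟩⟩ := exists_equiv_sigma hNA
  have hMc : Countable M := mk_le_aleph0_iff.1 hM.le
  have hNc : Countable N := mk_le_aleph0_iff.1 hN.le
  have hFG : ∀ i, Nonempty (F i ≃[relLang (S i)] G i) := fun i => by
    -- The split is on the size of `A i`, since `ω`-categoricity says nothing when `A i` is finite.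
    rcases finite_or_infinite (A i) with hfin | hinf
    · obtain ⟨e₁⟩ := nonempty_equiv_of_finite (hF i)
      obtain ⟨e₂⟩ := nonempty_equiv_of_finite (hG i)
      exact ⟨e₂.comp e₁.symm⟩
    · have : Countable (F i) := (eF.injective.comp (sigma_mk_injective (i := i))).countable
      have : Countable (G i) := (eG.injective.comp (sigma_mk_injective (i := i))).countable
      have : Infinite (F i) := (hF i).infinite
      have : Infinite (G i) := (hG i).infinite
      exact ((h i).resolve_left (not_finite_iff_infinite.2 hinf)).nonempty_equiv (hF i) (hG i)
  obtain ⟨e⟩ := nonempty_sigma_equiv (S := S) fun i => (hFG i).some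
  exact ⟨(eG.comp e).comp eF.symm⟩

end PComb

theorem proposition2p1 {Sym : ℕ → Type u} {I : Type v} {M : Type w}
    (S : I → ∀ n, Set (Sym n)) (P : I → Set M)
    [𝒜 : ∀ i, (PComb.relLang (S i)).Structure (P i)]
    (hne : ∀ i, (P i).Nonempty)
    (hdisj : ∀ i j, i ≠ j → Disjoint (P i) (P j))
    (hlang : ∀ i, (PComb.relLang (S i)).card ≤ ℵ₀)
    (hI : #I ≤ ℵ₀)
    (hinf : Infinite (PComb.PUnion P)) :
    PComb.OmegaCategorical (PComb.combLang S) (PComb.PUnion P) ↔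
      Finite I ∧ ∀ i, Finite (P i) ∨ PComb.OmegaCategorical (PComb.relLang (S i)) (P i) := by

  obtain ⟨e⟩ := PComb.nonempty_sigma_equiv_pUnion S P hdisj
  have hcard := PComb.card_combLang_le hlang hI
  have : Infinite (Σ i, P i) := e.toEquiv.infinite_iff.2 hinf
  have : ∀ i, Nonempty (P i) := fun i => (hne i).to_subtype
  rw [show PComb.OmegaCategorical (PComb.combLang S) (PComb.PUnion P) ↔
      PComb.OmegaCategorical (PComb.combLang S) (Σ i, P i) by
    rw [PComb.OmegaCategorical, PComb.OmegaCategorical,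
      Language.ElementarilyEquivalent.completeTheory_eq
        (Language.StrongHomClass.elementarilyEquivalent e)] ]
  constructor
  · intro h
    have := PComb.finite_of_omegaCategorical_sigma hcard h
    -- The second alternative always applies, as finite structures are vacuously `ω`-categorical.
    exact ⟨this, fun i => Or.inr (PComb.omegaCategorical_component hcard h i)⟩
  · rintro ⟨_, h⟩
    exact PComb.omegaCategorical_sigma h
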